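/- Let $A_1,\dots,A_m\in\mathbb R^{n\times n}$ and $a_1,\dots,a_m\in\mathbb R^n$, and let $f=(f_1,\dots,f_m):\mathbb R^n\to\mathbb R^m$ be the quadratic map $$f_i(x)=\tfrac12\,x^TA_ix+a_i^Tx,\qquad i=1,\dots,m.$$ Let $\|x\|=\sqrt{x^Tx}$ for vectors, let $\|A_i\|$ denote the spectral norm of $A_i$, and let $\lambda_{\max}$, $\lambda_{\min}$ denote the largest and smallest eigenvalue of a symmetric matrix. Let $A=[a_1\ \cdots\ a_m]\in\mathbb R^{n\times m}$ and $$L=\sqrt{\sum_{i=1}^m\|A_i\|^2},\qquad L_{\rm new}=\sqrt{\lambda_{\max}\Big(\sum_{i=1}^mA_i^TA_i\Big)},\qquad \nu=\sigma_{\min}(A)=\sqrt{\lambda_{\min}(A^TA)}.$$ Then $L_{\rm new}\le L$. Moreover, for every real $\varepsilon<\nu/(2L_{\rm new})$ (where the right-hand side is read as $+\infty$ if $L_{\rm new}=0$), the image $$F_m(\varepsilon)=\{f(x): x\in\mathbb R^n,\ \|x\|\le\varepsilon\}$$ is a convex subset of $\mathbb R^m$. -/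

import Mathlib

noncomputable section

namespace QuadraticImage

open scoped Matrix

/-- The largest real eigenvalue of a square real matrix (used for symmetric matrices only). -/
def lambdaMax {k : ℕ} (M : Matrix (Fin k) (Fin k) ℝ) : ℝ :=
  sSup (spectrum ℝ M)

/-- The smallest real eigenvalue of a square real matrix (used for symmetric matrices only). -/
def lambdaMin {k : ℕ} (M : Matrix (Fin k) (Fin k) ℝ) : ℝ :=
  sInf (spectrum ℝ M)

/-- The quadratic map `f = (f₁, …, f_m)` with `f_i(x) = ½ xᵀ A_i x + a_iᵀ x`. -/
def quadMap {n m : ℕ} (A : Fin m → Matrix (Fin n) (Fin n) ℝ)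
    (a : Fin m → EuclideanSpace ℝ (Fin n)) (x : EuclideanSpace ℝ (Fin n)) :
    EuclideanSpace ℝ (Fin m) :=
  WithLp.toLp 2 fun i => (1 / 2 : ℝ) * (x.ofLp ⬝ᵥ (A i *ᵥ x.ofLp)) + (a i).ofLp ⬝ᵥ x.ofLp

/-- The image `F_m(ε)` of the closed Euclidean ball of radius `ε` about the origin. -/
def ballImage {n m : ℕ} (A : Fin m → Matrix (Fin n) (Fin n) ℝ)
    (a : Fin m → EuclideanSpace ℝ (Fin n)) (ε : ℝ) : Set (EuclideanSpace ℝ (Fin m)) :=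
  {y | ∃ x : EuclideanSpace ℝ (Fin n), ‖x‖ ≤ ε ∧ quadMap A a x = y}

/-- The `n × m` matrix `[a₁ … a_m]` with columns `a_i`. -/
def colMatrix {n m : ℕ} (a : Fin m → EuclideanSpace ℝ (Fin n)) : Matrix (Fin n) (Fin m) ℝ :=
  Matrix.of fun j i => a i j

/-- `ν = σ_min([a₁ … a_m])`, the square root of the smallest eigenvalue of the
`m × m` Gram matrix (so `ν = 0` when `m > n`). -/
def nu {n m : ℕ} (a : Fin m → EuclideanSpace ℝ (Fin n)) : ℝ :=
  Real.sqrt (lambdaMin ((colMatrix a)ᵀ * colMatrix a))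

open scoped Matrix.Norms.L2Operator in
/-- `L = √(∑ ‖A_i‖²)`, where `‖·‖` is the spectral norm. -/
def L {n m : ℕ} (A : Fin m → Matrix (Fin n) (Fin n) ℝ) : ℝ :=
  Real.sqrt (∑ i, ‖A i‖ ^ 2)

/-- `L_new = √(λ_max(∑ A_iᵀ A_i))`. -/
def Lnew {n m : ℕ} (A : Fin m → Matrix (Fin n) (Fin n) ℝ) : ℝ :=
  Real.sqrt (lambdaMax (∑ i, (A i)ᵀ * A i))

end QuadraticImage

end

/-!
Write `f = q + T` with `q x = ½ B(x, x)` and `T` linear, so that `ν ‖c‖ ≤ ‖Tᵀ c‖` for all `c`. If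
`ν > 0`, then `T` has a right inverse of norm at most `ν⁻¹`, namely `Tᵀ (T Tᵀ)⁻¹`. On the ball of
radius `ε` about the origin, `q` is Lipschitz with constant `‖B‖ ε`. Hence `f` is approximated by
`T` there, and the image of any smaller ball `closedBall x₀ ρ` contains the ball of radius
`(ν - ‖B‖ ε) ρ` around `f x₀`.

Let `x₀ = s x₁ + t x₂` be a convex combination of two points of the ball. By strong convexity the
ball of radius `ρ = s t ‖x₁ - x₂‖² / (2 ε)` around `x₀` is still contained in the big one, while
`s f(x₁) + t f(x₂)` differs from `f x₀` by `(s t / 2) B(x₁ - x₂, x₁ - x₂)`, whose norm is at most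
`‖B‖ ε ρ`. This value is therefore attained as soon as `2 ‖B‖ ε ≤ ν`. Finally `‖B‖ ≤ L_new`, since
`∑ (xᵀ A_i y)² ≤ ‖x‖² ∑ ‖A_i y‖²`.
-/

namespace QuadraticImage

open Metric Set
open scoped NNReal InnerProductSpace

section Ball

variable {E : Type*} [NormedAddCommGroup E] [InnerProductSpace ℝ E] {c x y : E} {r s t : ℝ}

theorem norm_combo_sq (hst : s + t = 1) (x y : E) :
    ‖s • x + t • y‖ ^ 2 = s * ‖x‖ ^ 2 + t * ‖y‖ ^ 2 - s * t * ‖x - y‖ ^ 2 := by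
  obtain rfl : t = 1 - s := by linarith
  rw [norm_add_sq_real, norm_sub_sq_real, inner_smul_left, inner_smul_right, norm_smul, norm_smul,
    mul_pow, mul_pow, Real.norm_eq_abs, Real.norm_eq_abs, sq_abs, sq_abs, conj_trivial]
  ring

theorem closedBall_combo_subset_closedBall (hr : 0 < r) (hx : x ∈ closedBall c r)
    (hy : y ∈ closedBall c r) (hs : 0 ≤ s) (ht : 0 ≤ t) (hst : s + t = 1) :
    closedBall (s • x + t • y) (s * t * ‖x - y‖ ^ 2 / (2 * r)) ⊆ closedBall c r := by
  rw [mem_closedBall_iff_norm] at hx hy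
  set ρ := s * t * ‖x - y‖ ^ 2 / (2 * r) with hρ
  have hρ_mul : 2 * r * ρ = s * t * ‖x - y‖ ^ 2 := by rw [hρ]; field_simp
  have hcenter : s • x + t • y - c = s • (x - c) + t • (y - c) := by
    obtain rfl : t = 1 - s := by linarith
    module
  have hsq : ‖s • x + t • y - c‖ ^ 2 ≤ r ^ 2 - 2 * r * ρ :=
    calc ‖s • x + t • y - c‖ ^ 2
        = s * ‖x - c‖ ^ 2 + t * ‖y - c‖ ^ 2 - 2 * r * ρ := by
          rw [hcenter, norm_combo_sq hst, sub_sub_sub_cancel_right, hρ_mul]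
      _ ≤ s * r ^ 2 + t * r ^ 2 - 2 * r * ρ := by gcongr
      _ = r ^ 2 - 2 * r * ρ := by rw [← add_mul, hst, one_mul]
  have hρ_le : ρ ≤ r := by nlinarith [sq_nonneg ‖s • x + t • y - c‖]
  have hnorm : ‖s • x + t • y - c‖ ≤ r - ρ :=
    le_of_sq_le_sq (by linarith [sq_nonneg ρ, sub_sq r ρ]) (sub_nonneg.mpr hρ_le)
  exact closedBall_subset_closedBall' (by rw [dist_eq_norm]; linarith)

end Ball

section Quadratic

variable {E F : Type*} [NormedAddCommGroup E] [NormedAddCommGroup F]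

/-- The map `x ↦ ½ B(x, x) + T x`, the coordinate-free form of `quadMap`. The bilinear map `B` is
not assumed to be symmetric. -/
noncomputable def quadratic [NormedSpace ℝ E] [NormedSpace ℝ F] (B : E →L[ℝ] E →L[ℝ] F)
    (T : E →L[ℝ] F) (x : E) : F :=
  (1 / 2 : ℝ) • B x x + T x

theorem approximatesLinearOn_quadratic [NormedSpace ℝ E] [NormedSpace ℝ F]
    (B : E →L[ℝ] E →L[ℝ] F) (T : E →L[ℝ] F) (r : ℝ≥0) :
    ApproximatesLinearOn (quadratic B T) T (closedBall 0 r) (‖B‖₊ * r) := by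
  intro x hx y hy
  rw [mem_closedBall_zero_iff] at hx hy
  have hdiff : quadratic B T x - quadratic B T y - T (x - y) =
      (1 / 2 : ℝ) • (B x (x - y) + B (x - y) y) := by
    simp only [quadratic, map_sub, sub_apply]
    module
  calc ‖quadratic B T x - quadratic B T y - T (x - y)‖
      = 1 / 2 * ‖B x (x - y) + B (x - y) y‖ := by
        rw [hdiff, norm_smul, Real.norm_of_nonneg (by norm_num)]
    _ ≤ 1 / 2 * (‖B‖ * ‖x‖ * ‖x - y‖ + ‖B‖ * ‖x - y‖ * ‖y‖) := by
        gcongr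
        exact norm_add_le_of_le (B.le_opNorm₂ _ _) (B.le_opNorm₂ _ _)
    _ ≤ 1 / 2 * (‖B‖ * r * ‖x - y‖ + ‖B‖ * ‖x - y‖ * r) := by gcongr
    _ = ↑(‖B‖₊ * r) * ‖x - y‖ := by push_cast; ring

theorem combo_quadratic_sub_quadratic_combo [NormedSpace ℝ E] [NormedSpace ℝ F]
    (B : E →L[ℝ] E →L[ℝ] F) (T : E →L[ℝ] F) {s t : ℝ} (hst : s + t = 1) (x y : E) :
    s • quadratic B T x + t • quadratic B T y - quadratic B T (s • x + t • y) =
      (s * t / 2) • B (x - y) (x - y) := by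
  obtain rfl : t = 1 - s := by linarith
  simp only [quadratic, map_add, map_sub, map_smul, add_apply, sub_apply, smul_apply]
  module

theorem convex_image_quadratic_of_nonlinearRightInverse [InnerProductSpace ℝ E] [CompleteSpace E]
    [NormedSpace ℝ F] (B : E →L[ℝ] E →L[ℝ] F) {T : E →L[ℝ] F} (R : T.NonlinearRightInverse)
    {r : ℝ} (hr : 2 * ‖B‖ * r ≤ (R.nnnorm : ℝ)⁻¹) :
    Convex ℝ (quadratic B T '' closedBall 0 r) := by
  rcases le_or_gt r 0 with hr0 | hr0
  · exact ((subsingleton_closedBall 0 hr0).image _).convex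
  lift r to ℝ≥0 using hr0.le
  rintro _ ⟨x, hx, rfl⟩ _ ⟨y, hy, rfl⟩ s t hs ht hst
  set ρ := s * t * ‖x - y‖ ^ 2 / (2 * r) with hρ
  have hρ0 : 0 ≤ ρ := by positivity
  have hsub : closedBall (s • x + t • y) ρ ⊆ closedBall 0 r :=
    closedBall_combo_subset_closedBall hr0 hx hy hs ht hst
  have hsurj := (approximatesLinearOn_quadratic B T r).surjOn_closedBall_of_nonlinearRightInverse
    R hρ0 hsub
  refine image_mono hsub (hsurj ?_)
  rw [mem_closedBall_iff_norm, combo_quadratic_sub_quadratic_combo B T hst, norm_smul,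
    Real.norm_of_nonneg (by positivity)]
  calc s * t / 2 * ‖B (x - y) (x - y)‖
      ≤ s * t / 2 * (‖B‖ * ‖x - y‖ * ‖x - y‖) := by gcongr; exact B.le_opNorm₂ _ _
    _ = (2 * ‖B‖ * r - ‖B‖ * r) * ρ := by rw [hρ]; field_simp; ring
    _ ≤ ((R.nnnorm : ℝ)⁻¹ - ↑(‖B‖₊ * r)) * ρ := by push_cast; gcongr

end Quadratic

section Hilbert

variable {E F : Type*} [NormedAddCommGroup E] [InnerProductSpace ℝ E] [CompleteSpace E]
  [NormedAddCommGroup F] [InnerProductSpace ℝ F] [CompleteSpace F] {T : E →L[ℝ] F}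

theorem inner_apply_adjoint_self (T : E →L[ℝ] F) (c : F) :
    ⟪T (T.adjoint c), c⟫_ℝ = ‖T.adjoint c‖ ^ 2 := by
  rw [← ContinuousLinearMap.adjoint_inner_right, real_inner_self_eq_norm_sq]

theorem isUnit_comp_adjoint_of_le_norm_adjoint {ν : ℝ≥0} (hν : 0 < ν)
    (hT : ∀ c, ν * ‖c‖ ≤ ‖T.adjoint c‖) : IsUnit (T ∘L T.adjoint) := by
  refine ContinuousLinearMap.isUnit_of_forall_le_norm_inner_map _ (pow_pos hν 2) fun c => ?_
  calc ‖c‖ ^ 2 * ↑(ν ^ 2) = (ν * ‖c‖) ^ 2 := by push_cast; ring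
    _ ≤ ‖T.adjoint c‖ ^ 2 := by gcongr; exact hT c
    _ = ⟪T (T.adjoint c), c⟫_ℝ := (inner_apply_adjoint_self T c).symm
    _ ≤ _ := Real.le_norm_self _

theorem exists_nonlinearRightInverse_of_le_norm_adjoint {ν : ℝ≥0} (hν : 0 < ν)
    (hT : ∀ c, ν * ‖c‖ ≤ ‖T.adjoint c‖) :
    ∃ R : T.NonlinearRightInverse, R.nnnorm = ν⁻¹ := by
  choose S hS using ((T ∘L T.adjoint).isUnit_iff_bijective.mp
    (isUnit_comp_adjoint_of_le_norm_adjoint hν hT)).surjective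
  have hbound (v : F) : ν * ‖T.adjoint (S v)‖ ≤ ‖v‖ := by
    have hsq : ‖T.adjoint (S v)‖ ^ 2 ≤ ‖v‖ * ‖S v‖ :=
      calc ‖T.adjoint (S v)‖ ^ 2 = ⟪T (T.adjoint (S v)), S v⟫_ℝ :=
            (inner_apply_adjoint_self T _).symm
        _ = ⟪v, S v⟫_ℝ := congrArg (⟪·, S v⟫_ℝ) (hS v)
        _ ≤ ‖v‖ * ‖S v‖ := real_inner_le_norm _ _
    rcases (norm_nonneg (T.adjoint (S v))).eq_or_lt with h0 | h0
    · rw [← h0, mul_zero]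
      exact norm_nonneg v
    · refine le_of_mul_le_mul_right ?_ h0
      calc ν * ‖T.adjoint (S v)‖ * ‖T.adjoint (S v)‖
          = ν * ‖T.adjoint (S v)‖ ^ 2 := by ring
        _ ≤ ν * (‖v‖ * ‖S v‖) := by gcongr
        _ = ‖v‖ * (ν * ‖S v‖) := by ring
        _ ≤ ‖v‖ * ‖T.adjoint (S v)‖ := by gcongr; exact hT _
  refine ⟨⟨fun v => T.adjoint (S v), ν⁻¹, fun v => ?_, hS⟩, rfl⟩
  rw [NNReal.coe_inv, le_inv_mul_iff₀ (NNReal.coe_pos.mpr hν)]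
  exact hbound v

theorem convex_image_quadratic_of_le_norm_adjoint {B : E →L[ℝ] E →L[ℝ] F} {Λ ν r : ℝ}
    (hB : ‖B‖ ≤ Λ) (hT : ∀ c, ν * ‖c‖ ≤ ‖T.adjoint c‖) (hr : 2 * Λ * r ≤ ν) :
    Convex ℝ (quadratic B T '' closedBall 0 r) := by
  rcases le_or_gt r 0 with hr0 | hr0
  · exact ((subsingleton_closedBall 0 hr0).image _).convex
  rcases eq_or_ne B 0 with rfl | hB0
  · have hlinear : quadratic (0 : E →L[ℝ] E →L[ℝ] F) T = T := by ext x; simp [quadratic]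
    rw [hlinear]
    exact (convex_closedBall 0 r).linear_image T.toLinearMap
  have hBν : 2 * ‖B‖ * r ≤ ν := le_trans (by gcongr) hr
  have hν : 0 < ν := lt_of_lt_of_le (by positivity) hBν
  lift ν to ℝ≥0 using hν.le
  obtain ⟨R, hR⟩ := exists_nonlinearRightInverse_of_le_norm_adjoint (T := T) hν hT
  exact convex_image_quadratic_of_nonlinearRightInverse B R (by simpa [hR] using hBν)

end Hilbert

section Matrix

open Matrix
open scoped MatrixOrder

variable {ι κ : Type*} {k n m : ℕ}

theorem inner_toEuclideanLin_transpose_mul_self [Fintype ι] [Fintype κ] [DecidableEq κ]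
    (M : Matrix ι κ ℝ) (x : EuclideanSpace ℝ κ) :
    ⟪toEuclideanLin (Mᵀ * M) x, x⟫_ℝ = ‖toEuclideanLin M x‖ ^ 2 := by
  classical
  rw [toLpLin_mul_same, ← conjTranspose_eq_transpose_of_trivial,
    toEuclideanLin_conjTranspose_eq_adjoint, LinearMap.comp_apply, LinearMap.adjoint_inner_left,
    real_inner_self_eq_norm_sq]

theorem posSemidef_transpose_mul_self [Fintype ι] [Finite κ] (M : Matrix ι κ ℝ) :
    (Mᵀ * M).PosSemidef :=
  conjTranspose_eq_transpose_of_trivial M ▸ posSemidef_conjTranspose_mul_self M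

theorem inner_toEuclideanLin_le_lambdaMax {M : Matrix (Fin k) (Fin k) ℝ} (hM : M.IsHermitian)
    (x : EuclideanSpace ℝ (Fin k)) : ⟪toEuclideanLin M x, x⟫_ℝ ≤ lambdaMax M * ‖x‖ ^ 2 := by
  have hle : M ≤ algebraMap ℝ _ (lambdaMax M) :=
    le_algebraMap_of_spectrum_le (fun _ hμ => le_csSup finite_real_spectrum.bddAbove hμ) hM
  have h := (isPositive_toEuclideanLin_iff.mpr (le_iff.mp hle)).2 x
  simpa [Algebra.algebraMap_eq_smul_one, inner_sub_left, inner_smul_left] using h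

theorem lambdaMin_le_inner_toEuclideanLin {M : Matrix (Fin k) (Fin k) ℝ} (hM : M.IsHermitian)
    (x : EuclideanSpace ℝ (Fin k)) : lambdaMin M * ‖x‖ ^ 2 ≤ ⟪toEuclideanLin M x, x⟫_ℝ := by
  have hle : algebraMap ℝ _ (lambdaMin M) ≤ M :=
    algebraMap_le_of_le_spectrum (fun _ hμ => csInf_le finite_real_spectrum.bddBelow hμ) hM
  have h := (isPositive_toEuclideanLin_iff.mpr (le_iff.mp hle)).2 x
  simpa [Algebra.algebraMap_eq_smul_one, inner_sub_left, inner_smul_left] using h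

theorem lambdaMax_nonneg {M : Matrix (Fin k) (Fin k) ℝ} (hM : M.PosSemidef) : 0 ≤ lambdaMax M :=
  Real.sSup_nonneg (posSemidef_iff_isHermitian_and_spectrum_nonneg.mp hM).2

theorem lambdaMin_nonneg {M : Matrix (Fin k) (Fin k) ℝ} (hM : M.PosSemidef) : 0 ≤ lambdaMin M :=
  Real.sInf_nonneg (posSemidef_iff_isHermitian_and_spectrum_nonneg.mp hM).2

section Norm

open scoped Matrix.Norms.L2Operator

theorem lambdaMax_le_norm (M : Matrix (Fin k) (Fin k) ℝ) : lambdaMax M ≤ ‖M‖ := by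
  refine Real.sSup_le (fun μ hμ => ?_) (norm_nonneg M)
  cases isEmpty_or_nonempty (Fin k)
  · simp [spectrum.of_subsingleton] at hμ
  · exact (Real.le_norm_self μ).trans (spectrum.norm_le_norm_of_mem hμ)

theorem Lnew_le_L (A : Fin m → Matrix (Fin n) (Fin n) ℝ) : Lnew A ≤ L A := by
  refine Real.sqrt_le_sqrt ?_
  calc lambdaMax (∑ i, (A i)ᵀ * A i)
      ≤ ‖∑ i, (A i)ᵀ * A i‖ := lambdaMax_le_norm _
    _ ≤ ∑ i, ‖(A i)ᵀ * A i‖ := norm_sum_le _ _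
    _ = ∑ i, ‖A i‖ ^ 2 := Finset.sum_congr rfl fun i _ => by
      rw [← conjTranspose_eq_transpose_of_trivial, l2_opNorm_conjTranspose_mul_self, sq]

end Norm

variable (A : Fin m → Matrix (Fin n) (Fin n) ℝ) (a : Fin m → EuclideanSpace ℝ (Fin n))

theorem Lnew_nonneg : 0 ≤ Lnew A := Real.sqrt_nonneg _

theorem nu_nonneg : 0 ≤ nu a := Real.sqrt_nonneg _

theorem sum_norm_toEuclideanLin_sq_le (x : EuclideanSpace ℝ (Fin n)) :
    ∑ i, ‖toEuclideanLin (A i) x‖ ^ 2 ≤ Lnew A ^ 2 * ‖x‖ ^ 2 := by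
  have hpsd : (∑ i, (A i)ᵀ * A i).PosSemidef :=
    posSemidef_sum _ fun i _ => posSemidef_transpose_mul_self (A i)
  calc ∑ i, ‖toEuclideanLin (A i) x‖ ^ 2
      = ⟪toEuclideanLin (∑ i, (A i)ᵀ * A i) x, x⟫_ℝ := by
        simp_rw [map_sum, LinearMap.sum_apply, sum_inner, inner_toEuclideanLin_transpose_mul_self]
    _ ≤ lambdaMax (∑ i, (A i)ᵀ * A i) * ‖x‖ ^ 2 := inner_toEuclideanLin_le_lambdaMax hpsd.1 x
    _ = Lnew A ^ 2 * ‖x‖ ^ 2 := by rw [Lnew, Real.sq_sqrt (lambdaMax_nonneg hpsd)]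

theorem norm_toLp_inner_toEuclideanLin_le (x y : EuclideanSpace ℝ (Fin n)) :
    ‖WithLp.toLp 2 fun i => ⟪x, toEuclideanLin (A i) y⟫_ℝ‖ ≤ Lnew A * ‖x‖ * ‖y‖ := by
  have hL := Lnew_nonneg A
  refine le_of_sq_le_sq ?_ (by positivity)
  calc ‖WithLp.toLp 2 fun i => ⟪x, toEuclideanLin (A i) y⟫_ℝ‖ ^ 2
      = ∑ i, ⟪x, toEuclideanLin (A i) y⟫_ℝ ^ 2 := EuclideanSpace.real_norm_sq_eq _
    _ ≤ ∑ i, ‖x‖ ^ 2 * ‖toEuclideanLin (A i) y‖ ^ 2 := by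
        refine Finset.sum_le_sum fun i _ => ?_
        rw [← mul_pow, ← sq_abs]
        gcongr
        exact abs_real_inner_le_norm _ _
    _ ≤ ‖x‖ ^ 2 * (Lnew A ^ 2 * ‖y‖ ^ 2) := by
        rw [← Finset.mul_sum]
        gcongr
        exact sum_norm_toEuclideanLin_sq_le A y
    _ = (Lnew A * ‖x‖ * ‖y‖) ^ 2 := by ring

/-- The bilinear map `(x, y) ↦ (xᵀ A_i y)_i`, whose diagonal is twice the quadratic part of
`quadMap`. It is not symmetrized. -/
noncomputable def bilinPart : EuclideanSpace ℝ (Fin n) →L[ℝ] EuclideanSpace ℝ (Fin n) →L[ℝ]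
    EuclideanSpace ℝ (Fin m) :=
  (LinearMap.mk₂ ℝ (fun x y => WithLp.toLp 2 fun i => ⟪x, toEuclideanLin (A i) y⟫_ℝ)
    (fun x x' y => by ext i; simp only [inner_add_left, PiLp.add_apply])
    (fun c x y => by ext i; simp only [real_inner_smul_left, PiLp.smul_apply, smul_eq_mul])
    (fun x y y' => by ext i; simp only [map_add, inner_add_right, PiLp.add_apply])
    (fun c x y => by
      ext i; simp only [map_smul, real_inner_smul_right, PiLp.smul_apply, smul_eq_mul])
  ).mkContinuous₂ (Lnew A) (norm_toLp_inner_toEuclideanLin_le A)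

theorem bilinPart_apply (x y : EuclideanSpace ℝ (Fin n)) (i : Fin m) :
    bilinPart A x y i = x.ofLp ⬝ᵥ (A i *ᵥ y.ofLp) :=
  (EuclideanSpace.inner_eq_star_dotProduct x (toEuclideanLin (A i) y)).trans (dotProduct_comm _ _)

theorem norm_bilinPart_le : ‖bilinPart A‖ ≤ Lnew A :=
  LinearMap.mkContinuous₂_norm_le _ (Lnew_nonneg A) _

/-- The linear map `x ↦ (a_iᵀ x)_i`, the linear part of `quadMap`. -/
noncomputable def linPart : EuclideanSpace ℝ (Fin n) →L[ℝ] EuclideanSpace ℝ (Fin m) :=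
  (toEuclideanLin (colMatrix a)ᵀ).toContinuousLinearMap

theorem linPart_apply (x : EuclideanSpace ℝ (Fin n)) (i : Fin m) :
    linPart a x i = (a i).ofLp ⬝ᵥ x.ofLp := rfl

theorem adjoint_linPart_apply (c : EuclideanSpace ℝ (Fin m)) :
    (linPart a).adjoint c = toEuclideanLin (colMatrix a) c := by
  rw [linPart, ← LinearMap.adjoint_toContinuousLinearMap,
    ← toEuclideanLin_conjTranspose_eq_adjoint, conjTranspose_eq_transpose_of_trivial,
    transpose_transpose, LinearMap.coe_toContinuousLinearMap']

theorem nu_mul_norm_le_norm_adjoint_linPart (c : EuclideanSpace ℝ (Fin m)) :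
    nu a * ‖c‖ ≤ ‖(linPart a).adjoint c‖ := by
  have hpsd := posSemidef_transpose_mul_self (colMatrix a)
  refine le_of_sq_le_sq ?_ (norm_nonneg _)
  calc (nu a * ‖c‖) ^ 2
      = lambdaMin ((colMatrix a)ᵀ * colMatrix a) * ‖c‖ ^ 2 := by
        rw [mul_pow, nu, Real.sq_sqrt (lambdaMin_nonneg hpsd)]
    _ ≤ ⟪toEuclideanLin ((colMatrix a)ᵀ * colMatrix a) c, c⟫_ℝ :=
        lambdaMin_le_inner_toEuclideanLin hpsd.1 c
    _ = ‖(linPart a).adjoint c‖ ^ 2 := by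
        rw [inner_toEuclideanLin_transpose_mul_self, adjoint_linPart_apply]

theorem quadMap_eq_quadratic : quadMap A a = quadratic (bilinPart A) (linPart a) := by
  ext x i
  simp only [quadMap, quadratic, PiLp.add_apply, PiLp.smul_apply, smul_eq_mul, bilinPart_apply,
    linPart_apply]

theorem ballImage_eq_image_quadratic (ε : ℝ) :
    ballImage A a ε = quadratic (bilinPart A) (linPart a) '' closedBall 0 ε := by
  ext y
  simp only [ballImage, quadMap_eq_quadratic, mem_ofPred_eq, mem_image, mem_closedBall_zero_iff]

end Matrix

theorem two_mul_mul_le_of_eq_zero_or_lt_div {c ν ε : ℝ} (hc : 0 ≤ c) (hν : 0 ≤ ν)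
    (hε : c = 0 ∨ ε < ν / (2 * c)) : 2 * c * ε ≤ ν := by
  rcases hc.eq_or_lt' with rfl | hc
  · simpa using hν
  · exact mul_comm ε (2 * c) ▸ ((lt_div_iff₀ (by positivity)).mp (hε.resolve_left hc.ne')).le

end QuadraticImage

theorem theorem2_general {n m : ℕ} (A : Fin m → Matrix (Fin n) (Fin n) ℝ)
    (a : Fin m → EuclideanSpace ℝ (Fin n)) :
    QuadraticImage.Lnew A ≤ QuadraticImage.L A ∧
      ∀ ε : ℝ, 2 * QuadraticImage.Lnew A * ε ≤ QuadraticImage.nu a →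
        Convex ℝ (QuadraticImage.ballImage A a ε) := by
  refine ⟨QuadraticImage.Lnew_le_L A, fun ε hε => ?_⟩
  rw [QuadraticImage.ballImage_eq_image_quadratic]
  exact QuadraticImage.convex_image_quadratic_of_le_norm_adjoint
    (QuadraticImage.norm_bilinPart_le A) (QuadraticImage.nu_mul_norm_le_norm_adjoint_linPart a) hε

/-- When `Lnew A = 0` the threshold `ν / (2 L_new)` is read as `+∞`. -/
theorem theorem2 {n m : ℕ} (A : Fin m → Matrix (Fin n) (Fin n) ℝ)
    (a : Fin m → EuclideanSpace ℝ (Fin n)) :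
    QuadraticImage.Lnew A ≤ QuadraticImage.L A ∧
      ∀ ε : ℝ,
        (QuadraticImage.Lnew A = 0 ∨
          ε < QuadraticImage.nu a / (2 * QuadraticImage.Lnew A)) →
        Convex ℝ (QuadraticImage.ballImage A a ε) := by
  refine (theorem2_general A a).imp_right fun hconvex ε hε => hconvex ε ?_
  exact QuadraticImage.two_mul_mul_le_of_eq_zero_or_lt_div (QuadraticImage.Lnew_nonneg A)
    (QuadraticImage.nu_nonneg a) hε
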